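/- Let $G$ be a group and let $\mathbf{Set}^{G^{\mathrm{op}}}$ be the topos of right $G$-sets. A geometric morphism $f\colon \mathcal{E}\to\mathcal{F}$ between toposes (elementary toposes) is \emph{connected} if its inverse image functor $f^{*}\colon\mathcal{F}\to\mathcal{E}$ is fully faithful, and \emph{hyperconnected} if moreover the essential image of $f^{*}$ is closed under subobjects in $\mathcal{E}$. A (hyperconnected) \emph{quotient} of $\mathcal{E}$ is a connected (respectively hyperconnected) geometric morphism $f\colon\mathcal{E}\to\mathcal{F}$ to some topos $\mathcal{F}$, where $f$ and $f'\colon\mathcal{E}\to\mathcal{F}'$ are identified if there is an equivalence $e\colon\mathcal{F}\to\mathcal{F}'$ with $e\circ f\cong f'$. A filter of the lattice $\mathrm{Sub}(G)$ of subgroups of $G$ (a non-empty, upward closed set of subgroups that is closed under binary intersections) is \emph{conjugate closed} if it is closed under conjugation by elements of $G$. A topological group structure on $G$ (not necessarily Hausdorff) is \emph{simple} if the open subgroups form a neighbourhood base of the identity element. Every connected geometric morphism from $\mathbf{Set}^{G^{\mathrm{op}}}$ to a topos is hyperconnected, so that the quotients and the hyperconnected quotients of $\mathbf{Set}^{G^{\mathrm{op}}}$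 are the same, and the following three classes correspond bijectively: \begin{enumerate} \item quotients (equivalently, hyperconnected quotients) of $\mathbf{Set}^{G^{\mathrm{op}}}$; \item conjugate closed filters of $\mathrm{Sub}(G)$; \item simple topological group structures on $G$. \end{enumerate} Explicitly, if a quotient, represented by $f$, corresponds to the filter $\Phi$ and to the topology $\tau$, then a right $G$-set lies in the essential image of $f^{*}$ if and only if the stabilizers of all its elements belong to $\Phi$; the set $\Phi$ consists of the $\tau$-open subgroups of $G$; and $\tau$ is the unique simple topological group structure on $G$ that induces the quotient, in the following sense. A topology $\tau$ on $G$ \emph{induces} $f\colon\mathbf{Set}^{G^{\mathrm{op}}}\to\mathcal{F}$ if there is an equivalence $e$ from the full subcategory $\mathrm{Cont}(G,\tau)\subseteq\mathbf{Set}^{G^{\mathrm{op}}}$ of the right $G$-sets $X$ whose action map $X\times G\to X$ is continuous ($X$ being discrete) to $\mathcal{F}$ such that $f^{*}\circ e$ is naturally isomorphic to the inclusion $\mathrm{Cont}(G,\tau)\hookrightarrow\mathbf{Set}^{G^{\mathrm{op}}}$. In particular, every quotient of the topos of $G$-sets is induced by a (simple) topological group structure on $G$. -/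

import Mathlib

open CategoryTheory CategoryTheory.Limits Opposite Topology

universe v w v₁ u₁ v₂ u₂ u

/-! ## Toposes, geometric morphisms and quotients of a topos -/

/-- An elementary topos: finite limits, cartesian closed, with a subobject classifier. -/
class IsElementaryTopos (C : Type u₁) [Category.{v₁} C] : Prop where
  hasFiniteLimits : HasFiniteLimits C
  exponentiable : ∀ X : C, (prod.functor.obj X).IsLeftAdjoint
  hasSubobjectClassifier : HasSubobjectClassifier C

/-- A geometric morphism `E → F`: a direct image `f_* : E ⥤ F` together with a finite limit
preserving left adjoint `f^* : F ⥤ E`, the inverse image. -/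
structure GeometricMorphism (E : Type u₁) [Category.{v₁} E] (F : Type u₂) [Category.{v₂} F] where
  directImage : E ⥤ F
  inverseImage : F ⥤ E
  adj : inverseImage ⊣ directImage
  preservesFiniteLimits : PreservesFiniteLimits inverseImage

namespace GeometricMorphism

variable {E : Type u₁} [Category.{v₁} E] {F : Type u₂} [Category.{v₂} F]

/-- A geometric morphism is connected if its inverse image is fully faithful. -/
def IsConnected (f : GeometricMorphism E F) : Prop :=
  f.inverseImage.Full ∧ f.inverseImage.Faithful

/-- A geometric morphism is hyperconnected if its inverse image is fully faithful, with essential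
image closed under subobjects. -/
def IsHyperconnected (f : GeometricMorphism E F) : Prop :=
  f.IsConnected ∧
    ∀ ⦃X Y : E⦄ (m : X ⟶ Y) [Mono m], f.inverseImage.essImage Y → f.inverseImage.essImage X

end GeometricMorphism

/-- A connected geometric morphism from `E` to some elementary topos. -/
structure ConnectedMorphismFrom (E : Type u₁) [Category.{v₁} E] where
  codomain : Type u₁
  [category : Category.{v₁} codomain]
  [isTopos : IsElementaryTopos codomain]
  morphism : GeometricMorphism E codomain
  isConnected : morphism.IsConnected

attribute [instance] ConnectedMorphismFrom.category ConnectedMorphismFrom.isTopos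

/-- Two connected geometric morphisms `f : E → F`, `f' : E → F'` are identified if there is an
equivalence `e : F ≌ F'` with `e ∘ f ≅ f'`, expressed on inverse images. -/
instance connectedMorphismSetoid (E : Type u₁) [Category.{v₁} E] :
    Setoid (ConnectedMorphismFrom E) where
  r P Q := ∃ e : P.codomain ≌ Q.codomain,
    Nonempty (e.functor ⋙ Q.morphism.inverseImage ≅ P.morphism.inverseImage)
  iseqv :=
    { refl := fun P => ⟨CategoryTheory.Equivalence.refl, ⟨Functor.leftUnitor _⟩⟩
      symm := by
        rintro P Q ⟨e, ⟨α⟩⟩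
        exact ⟨e.symm, ⟨Functor.isoWhiskerLeft e.inverse α.symm ≪≫
          (Functor.associator _ _ _).symm ≪≫
          Functor.isoWhiskerRight e.counitIso _ ≪≫ Functor.leftUnitor _⟩⟩
      trans := by
        rintro P Q R ⟨e, ⟨α⟩⟩ ⟨e', ⟨β⟩⟩
        exact ⟨e.trans e', ⟨Functor.associator _ _ _ ≪≫
          Functor.isoWhiskerLeft e.functor β ≪≫ α⟩⟩ }

/-- The quotients of `E`: connected geometric morphisms from `E` up to equivalence. -/
def ConnectedQuotient (E : Type u₁) [Category.{v₁} E] :=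
  Quotient (connectedMorphismSetoid E)

/-- The quotient of `E` represented by a connected geometric morphism from `E`. -/
def ConnectedMorphismFrom.quotient {E : Type u₁} [Category.{v₁} E] (P : ConnectedMorphismFrom E) :
    ConnectedQuotient E :=
  Quotient.mk (connectedMorphismSetoid E) P

/-! ## Right `G`-sets -/

/-- The topos of right `G`-sets, as presheaves on the one-object category of `G`. -/
abbrev GSets (G : Type u) [Group G] := (SingleObj G)ᵒᵖ ⥤ Type u

namespace GSets

variable {G : Type u} [Group G]

/-- The underlying set of a right `G`-set. -/
abbrev carrier (X : GSets G) : Type u := X.obj (op (SingleObj.star G))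

/-- The right action `x · g`. -/
def act (X : GSets G) (x : X.carrier) (g : G) : X.carrier :=
  X.map (Quiver.Hom.op (SingleObj.toEnd G g : SingleObj.star G ⟶ SingleObj.star G)) x

theorem act_one (X : GSets G) (x : X.carrier) : X.act x 1 = x := by
  have h := X.map_id (op (SingleObj.star G))
  exact ConcreteCategory.congr_hom h x

theorem act_mul (X : GSets G) (x : X.carrier) (g h : G) :
    X.act x (g * h) = X.act (X.act x g) h := by
  have e := X.map_comp
    (Quiver.Hom.op (SingleObj.toEnd G g : SingleObj.star G ⟶ SingleObj.star G))
    (Quiver.Hom.op (SingleObj.toEnd G h : SingleObj.star G ⟶ SingleObj.star G))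
  exact ConcreteCategory.congr_hom e x

/-- The stabilizer subgroup of an element of a right `G`-set. -/
def stabilizer (X : GSets G) (x : X.carrier) : Subgroup G where
  carrier := {g | X.act x g = x}
  one_mem' := X.act_one x
  mul_mem' := by
    intro a b ha hb
    change X.act x a = x at ha
    change X.act x b = x at hb
    change X.act x (a * b) = x
    rw [act_mul, ha, hb]
  inv_mem' := by
    intro a ha
    change X.act x a = x at ha
    calc X.act x a⁻¹ = X.act (X.act x a) a⁻¹ := by rw [ha]
      _ = x := by rw [← act_mul, mul_inv_cancel, act_one]

/-- A right `G`-set is continuous for a topology on `G` if the action map `X × G → X` is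
continuous, where `X` carries the discrete topology. -/
def IsContinuous (τ : TopologicalSpace G) : ObjectProperty (GSets G) := fun X =>
  @Continuous (X.carrier × G) X.carrier (@instTopologicalSpaceProd X.carrier G ⊥ τ) ⊥
    fun p => X.act p.1 p.2

end GSets

/-- The category of continuous right `(G, τ)`-sets, a full subcategory of all right `G`-sets. -/
abbrev ContinuousGSets (G : Type u) [Group G] (τ : TopologicalSpace G) :=
  (GSets.IsContinuous τ).FullSubcategory

/-- A geometric morphism from the topos of `G`-sets is induced by the topology `τ` on `G` if it is
identified with the one whose inverse image is the inclusion of the continuous `G`-sets. -/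
def GeometricMorphism.IsInducedBy {G : Type u} [Group G] {F : Type u₂} [Category.{v₂} F]
    (f : GeometricMorphism (GSets G) F) (τ : TopologicalSpace G) : Prop :=
  ∃ e : ContinuousGSets G τ ≌ F,
    Nonempty (e.functor ⋙ f.inverseImage ≅ (GSets.IsContinuous τ).ι)

/-! ## Conjugate closed filters and simple group topologies -/

/-- Filters of the lattice of subgroups of `G` that are closed under conjugation. -/
def ConjClosedFilter (G : Type u) [Group G] :=
  {F : Order.PFilter (Subgroup G) //
    ∀ H ∈ F, ∀ g : G, H.map (MulAut.conj g).toMonoidHom ∈ F}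

/-- Topological group structures on `G` that are simple: the open subgroups form a neighbourhood
base of the identity element. -/
def SimpleGroupTopology (G : Type u) [Group G] :=
  {τ : GroupTopology G //
    (@nhds G τ.toTopologicalSpace 1).HasBasis
      (fun H : Subgroup G => IsOpen[τ.toTopologicalSpace] (H : Set G)) (fun H => (H : Set G))}

/-- The underlying topology of a simple topological group structure. -/
abbrev SimpleGroupTopology.topology {G : Type u} [Group G] (τ : SimpleGroupTopology G) :
    TopologicalSpace G :=
  τ.1.toTopologicalSpace

/-! A connected `f` exhibits its codomain as a full subcategory of the `G`-sets, the essential image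
of `f^*`. It is closed under finite limits, and the counit `f^* f_* X ⟶ X` is the universal map into
`X` from an object of it. Everything rests on recognizing this subcategory from its transitive
objects.

The topos of `G`-sets is Boolean: its subobjects are classified by the trivial set 2 = 1 + 1. The
terminal object is in the essential image, so both points of 2 lift along the counit. The lifts form
a section, which puts 2 in the image (`essImage_two`). A subobject of `Y` is an equalizer of two
maps `Y ⟶ 2`, so the image is closed under subobjects (`essImage_of_mono`); this is
hyperconnectedness. Closure under jointly surjective families follows (`essImage_of_cover`): the
counit is then epi, and its kernel pair, a subobject of a product in the image, is trivial. Hence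
`X` is in the image iff all its orbits `G/Stab(x)` are, and the subgroups `H` with `G/H` in the
image form a conjugate closed filter.

Conversely, for a conjugate closed filter Φ, the `G`-sets with stabilizers in Φ form a topos: finite
limits and 2 are inherited, and the elements with stabilizer in Φ give a coreflection, which also
supplies the exponentials. Since Φ is a neighbourhood base at 1 for a group topology whose open
subgroups are exactly Φ, these are the continuous `G`-sets. Finally, a fully faithful functor is
determined up to equivalence by its essential image, so the constructions are mutually inverse. -/

namespace GSets

variable {G : Type u} [Group G]

/-! ## Elements, equivariant maps and coset spaces -/

/-- The function underlying a morphism of right `G`-sets. -/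
def fn {X Y : GSets G} (f : X ⟶ Y) (x : X.carrier) : Y.carrier :=
  f.app (op (SingleObj.star G)) x

theorem fn_act {X Y : GSets G} (f : X ⟶ Y) (x : X.carrier) (g : G) :
    fn f (X.act x g) = Y.act (fn f x) g :=
  ConcreteCategory.congr_hom (f.naturality _) x

@[simp]
theorem fn_comp {X Y Z : GSets G} (f : X ⟶ Y) (g : Y ⟶ Z) (x : X.carrier) :
    fn (f ≫ g) x = fn g (fn f x) := rfl

@[simp]
theorem fn_id {X : GSets G} (x : X.carrier) : fn (𝟙 X) x = x := rfl

theorem hom_ext {X Y : GSets G} {f g : X ⟶ Y} (h : ∀ x, fn f x = fn g x) : f = g := by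
  ext ⟨⟨⟩⟩ x
  exact h x

/-- The morphism of right `G`-sets given by an equivariant function. -/
def homMk {X Y : GSets G} (φ : X.carrier → Y.carrier)
    (h : ∀ x g, φ (X.act x g) = Y.act (φ x) g) : X ⟶ Y where
  app _ := ↾φ
  naturality _ _ g := by
    ext x
    exact h x g.unop

theorem mem_stabilizer {X : GSets G} {x : X.carrier} {g : G} :
    g ∈ X.stabilizer x ↔ X.act x g = x := Iff.rfl

theorem stabilizer_le_fn {X Y : GSets G} (f : X ⟶ Y) (x : X.carrier) :
    X.stabilizer x ≤ Y.stabilizer (fn f x) := fun g hg => by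
  rw [mem_stabilizer] at hg ⊢
  rw [← fn_act, hg]

theorem act_act_inv (X : GSets G) (x : X.carrier) (g : G) : X.act (X.act x g) g⁻¹ = x := by
  rw [← act_mul, mul_inv_cancel, act_one]

theorem act_inv_act (X : GSets G) (x : X.carrier) (g : G) : X.act (X.act x g⁻¹) g = x := by
  rw [← act_mul, inv_mul_cancel, act_one]

theorem stabilizer_act_inv (X : GSets G) (x : X.carrier) (g : G) :
    X.stabilizer (X.act x g⁻¹) = (X.stabilizer x).map (MulAut.conj g).toMonoidHom := by
  ext k
  rw [Subgroup.mem_map_equiv, mem_stabilizer, mem_stabilizer, MulAut.conj_symm_apply, act_mul,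
    act_mul]
  constructor
  · intro h
    rw [h, act_inv_act]
  · intro h
    rw [← act_act_inv X (X.act (X.act x g⁻¹) k) g, h]

theorem mono_iff {X Y : GSets G} (f : X ⟶ Y) : Mono f ↔ Function.Injective (fn f) := by
  rw [NatTrans.mono_iff_mono_app]
  constructor
  · intro h
    exact (CategoryTheory.mono_iff_injective _).1 (h (op (SingleObj.star G)))
  · rintro h ⟨⟨⟩⟩
    exact (CategoryTheory.mono_iff_injective _).2 h

theorem epi_iff {X Y : GSets G} (f : X ⟶ Y) : Epi f ↔ Function.Surjective (fn f) := by
  rw [NatTrans.epi_iff_epi_app]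
  constructor
  · intro h
    exact (CategoryTheory.epi_iff_surjective _).1 (h (op (SingleObj.star G)))
  · rintro h ⟨⟨⟩⟩
    exact (CategoryTheory.epi_iff_surjective _).2 h

/-- The right `G`-set of a left action, with `x · g = g⁻¹ • x`. -/
def ofMulAction (G : Type u) [Group G] (X : Type u) [MulAction G X] : GSets G where
  obj _ := X
  map {_ _} g := ↾fun x => (show G from g.unop)⁻¹ • x
  map_id _ := by
    ext x
    change (1 : G)⁻¹ • x = x
    simp
  map_comp {_ _ _} g h := by
    ext x
    change ((show G from g.unop) * (show G from h.unop))⁻¹ • x =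
      (show G from h.unop)⁻¹ • (show G from g.unop)⁻¹ • x
    rw [mul_inv_rev, mul_smul]

/-- The transitive right `G`-set of cosets of a subgroup. -/
abbrev cosets (H : Subgroup G) : GSets G := ofMulAction G (G ⧸ H)

/-- The base point of a coset space. -/
def cosets.base (H : Subgroup G) : (cosets H).carrier := ((1 : G) : G ⧸ H)

theorem cosets.act_base (H : Subgroup G) (g : G) :
    (cosets H).act (base H) g = ((g⁻¹ : G) : G ⧸ H) := by
  exact congrArg (QuotientGroup.mk (s := H)) (mul_one g⁻¹)

theorem cosets.exists_act_base {H : Subgroup G} (x : (cosets H).carrier) :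
    ∃ g, (cosets H).act (base H) g = x := by
  obtain ⟨g, rfl⟩ := QuotientGroup.mk_surjective (show G ⧸ H from x)
  exact ⟨g⁻¹, by rw [act_base, inv_inv]⟩

@[simp]
theorem cosets.stabilizer_base (H : Subgroup G) : (cosets H).stabilizer (base H) = H := by
  ext g
  rw [mem_stabilizer, act_base]
  change ((g⁻¹ : G) : G ⧸ H) = ((1 : G) : G ⧸ H) ↔ _
  rw [QuotientGroup.eq]
  simp

/-- The morphism from a coset space sending the base point to a given element. -/
def cosets.desc {H : Subgroup G} {X : GSets G} (x : X.carrier) (hx : H ≤ X.stabilizer x) :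
    cosets H ⟶ X :=
  homMk (fun q : G ⧸ H => Quotient.liftOn' q (fun g => X.act x g⁻¹) fun a b hab => by
    have h := hx (QuotientGroup.leftRel_apply.1 hab)
    rw [mem_stabilizer] at h
    calc X.act x a⁻¹ = X.act (X.act x (a⁻¹ * b)) b⁻¹ := by rw [← act_mul, mul_inv_cancel_right]
      _ = X.act x b⁻¹ := by rw [h]) (by
    intro q g
    obtain ⟨k, rfl⟩ := QuotientGroup.mk_surjective (show G ⧸ H from q)
    change X.act x (g⁻¹ * k)⁻¹ = X.act (X.act x k⁻¹) g
    rw [← act_mul, mul_inv_rev, inv_inv])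

theorem cosets.fn_desc_base {H : Subgroup G} {X : GSets G} (x : X.carrier)
    (hx : H ≤ X.stabilizer x) : fn (desc x hx) (base H) = x := by
  change X.act x 1⁻¹ = x
  rw [inv_one, act_one]

/-- Orbit-stabilizer: this embeds `G/Stab(x)` in `X` as the orbit of `x`. -/
theorem cosets.mono_desc {X : GSets G} (x : X.carrier) :
    Mono (desc x (le_refl (X.stabilizer x))) := by
  rw [mono_iff]
  intro p q h
  obtain ⟨a, rfl⟩ := exists_act_base p
  obtain ⟨b, rfl⟩ := exists_act_base q
  rw [fn_act, fn_act, fn_desc_base] at h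
  -- It suffices that `a * b⁻¹` fixes the base point, that is, lies in the stabilizer of `x`; this
  -- is what `h` says.
  rw [← act_inv_act _ ((cosets _).act _ a) b, ← act_mul _ _ a]
  congr 1
  rw [← mem_stabilizer, stabilizer_base, mem_stabilizer, act_mul, h, act_act_inv]

/-! ## The two-element set -/

/-- The two-element set with trivial action. -/
def two (G : Type u) [Group G] : GSets G := (Functor.const _).obj (ULift.{u} Prop)

theorem two_act (b : (two G).carrier) (g : G) : (two G).act b g = b := rfl

/-- The characteristic morphism of an invariant subset. -/
def charMap (X : GSets G) (S : Set X.carrier) (hS : ∀ x g, X.act x g ∈ S ↔ x ∈ S) : X ⟶ two G :=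
  homMk (fun x => (ULift.up (x ∈ S) : ULift.{u} Prop)) fun x g =>
    congrArg ULift.up (propext (hS x g))

theorem act_mem_range_iff {X Y : GSets G} (m : X ⟶ Y) (y : Y.carrier) (g : G) :
    Y.act y g ∈ Set.range (fn m) ↔ y ∈ Set.range (fn m) := by
  constructor
  · rintro ⟨x, hx⟩
    exact ⟨X.act x g⁻¹, by rw [fn_act, hx, act_act_inv]⟩
  · rintro ⟨x, rfl⟩
    exact ⟨X.act x g, fn_act _ _ _⟩

end GSets

/-! ## Connected quotients of the topos of `G`-sets -/

namespace GeometricMorphism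

variable {G : Type u} [Group G] {F : Type w} [Category.{v} F] {f : GeometricMorphism (GSets G) F}

open GSets

/-- A morphism from an object of the essential image lifts along the counit. -/
theorem exists_comp_counit {E : Type u₁} [Category.{v₁} E] {F : Type u₂} [Category.{v₂} F]
    (f : GeometricMorphism E F) {X Y : E} (hY : f.inverseImage.essImage Y) (g : Y ⟶ X) :
    ∃ h : Y ⟶ f.inverseImage.obj (f.directImage.obj X), h ≫ f.adj.counit.app X = g := by
  obtain ⟨Z, ⟨i⟩⟩ := hY
  refine ⟨i.inv ≫ f.inverseImage.map (f.adj.homEquiv _ _ (i.hom ≫ g)), ?_⟩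
  have h := (f.adj.homEquiv Z X).symm_apply_apply (i.hom ≫ g)
  rw [Adjunction.homEquiv_counit] at h
  rw [Category.assoc]
  exact (congrArg (i.inv ≫ ·) h).trans (i.inv_hom_id_assoc g)

/-- Morphisms from an object of the essential image are determined by composing with the counit. -/
theorem IsConnected.hom_ext_counit {E : Type u₁} [Category.{v₁} E] {F : Type u₂}
    [Category.{v₂} F] {f : GeometricMorphism E F} (hf : f.IsConnected) {X Y : E}
    (hY : f.inverseImage.essImage Y)
    {g h : Y ⟶ f.inverseImage.obj (f.directImage.obj X)}
    (w : g ≫ f.adj.counit.app X = h ≫ f.adj.counit.app X) : g = h := by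
  have := hf.1
  obtain ⟨Z, ⟨i⟩⟩ := hY
  rw [← cancel_epi i.hom]
  obtain ⟨g', hg'⟩ := f.inverseImage.map_surjective (i.hom ≫ g)
  obtain ⟨h', hh'⟩ := f.inverseImage.map_surjective (i.hom ≫ h)
  rw [← hg', ← hh']
  congr 1
  apply (f.adj.homEquiv _ _).symm.injective
  rw [Adjunction.homEquiv_counit, Adjunction.homEquiv_counit, hg', hh', Category.assoc, w,
    Category.assoc]

/-- An object lies in the essential image as soon as the counit has a section. -/
theorem IsConnected.essImage_of_section {E : Type u₁} [Category.{v₁} E] {F : Type u₂}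
    [Category.{v₂} F] {f : GeometricMorphism E F} (hf : f.IsConnected) {X : E}
    (s : X ⟶ f.inverseImage.obj (f.directImage.obj X)) (hs : s ≫ f.adj.counit.app X = 𝟙 X) :
    f.inverseImage.essImage X :=
  ⟨f.directImage.obj X, ⟨⟨f.adj.counit.app X, s,
    hf.hom_ext_counit (Functor.obj_mem_essImage _ _)
      ((Category.assoc _ _ _).trans ((congrArg (_ ≫ ·) hs).trans
        ((Category.comp_id _).trans (Category.id_comp _).symm))), hs⟩⟩⟩

section

variable [HasFiniteLimits F]

/-- Full faithfulness lifts a finite diagram in the essential image to `F`; left exactness carries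
its limit there to the limit in `E`. -/
theorem isClosedUnderLimitsOfShape_essImage {E : Type u₁} [Category.{v₁} E] {F : Type u₂}
    [Category.{v₂} F] [HasFiniteLimits F] {f : GeometricMorphism E F} (hf : f.IsConnected)
    (J : Type) [SmallCategory J] [FinCategory J] :
    f.inverseImage.essImage.IsClosedUnderLimitsOfShape J := by
  have := hf.1
  have := hf.2
  have := f.preservesFiniteLimits
  infer_instance

theorem essImage_prod {E : Type u₁} [Category.{v₁} E] [HasFiniteLimits E] {F : Type u₂}
    [Category.{v₂} F] [HasFiniteLimits F] {f : GeometricMorphism E F} (hf : f.IsConnected)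
    {X Y : E} (hX : f.inverseImage.essImage X) (hY : f.inverseImage.essImage Y) :
    f.inverseImage.essImage (X ⨯ Y) := by
  have := isClosedUnderLimitsOfShape_essImage hf (Discrete WalkingPair)
  refine ObjectProperty.prop_limit _ _ ?_
  rintro ⟨⟨⟩⟩
  exacts [hX, hY]

theorem essImage_equalizer {E : Type u₁} [Category.{v₁} E] [HasFiniteLimits E] {F : Type u₂}
    [Category.{v₂} F] [HasFiniteLimits F] {f : GeometricMorphism E F} (hf : f.IsConnected)
    {X Y : E} (a b : X ⟶ Y) (hX : f.inverseImage.essImage X) (hY : f.inverseImage.essImage Y) :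
    f.inverseImage.essImage (equalizer a b) := by
  have := isClosedUnderLimitsOfShape_essImage hf WalkingParallelPair
  refine ObjectProperty.prop_limit _ _ ?_
  rintro ⟨⟩
  exacts [hX, hY]

theorem essImage_terminal {E : Type u₁} [Category.{v₁} E] [HasFiniteLimits E] {F : Type u₂}
    [Category.{v₂} F] [HasFiniteLimits F] {f : GeometricMorphism E F} (hf : f.IsConnected) :
    f.inverseImage.essImage (⊤_ E) := by
  have := isClosedUnderLimitsOfShape_essImage hf (Discrete PEmpty)
  refine ObjectProperty.prop_limit _ _ ?_
  rintro ⟨⟨⟩⟩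

/-- The two-element set lies in the essential image, since it is a coproduct of terminal
objects. -/
theorem essImage_two (hf : f.IsConnected) : f.inverseImage.essImage (two G) := by
  -- Each point of 2 lifts to a fixed point of `f^* f_* 2`. Being fixed is what makes the resulting
  -- section equivariant.
  have key (b : Prop) : ∃ t : (f.inverseImage.obj (f.directImage.obj (two G))).carrier,
      (∀ g, GSets.act _ t g = t) ∧ fn (f.adj.counit.app (two G)) t = ULift.up b := by
    obtain ⟨h, hh⟩ := f.exists_comp_counit (essImage_terminal hf)
      (charMap (⊤_ GSets G) {_x | b} (fun _ _ => Iff.rfl))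
    -- A fixed element of the abstract terminal object, obtained as the image of a point of the
    -- trivial set 2.
    let z : (⊤_ GSets G).carrier :=
      fn (terminal.from (two G)) (ULift.up True : ULift.{u} Prop)
    have hz (g : G) : GSets.act _ z g = z := by
      exact (fn_act (terminal.from (two G)) (ULift.up True : ULift.{u} Prop) g).symm
    refine ⟨fn h z, fun g => by rw [← fn_act, hz], ?_⟩
    rw [← fn_comp, hh]
    rfl
  choose t ht ht' using key
  exact hf.essImage_of_section
    (homMk (fun b : ULift.{u} Prop => t b.down) fun b g => (ht (ULift.down (α := Prop) b) g).symm)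
    (hom_ext fun b => ht' (ULift.down (α := Prop) b))

/-- The essential image of the inverse image of a connected geometric morphism from the topos of
`G`-sets is closed under subobjects: every subobject is classified by a map to the two-element
set. -/
theorem essImage_of_mono (hf : f.IsConnected) {X Y : GSets G} (m : X ⟶ Y) [Mono m]
    (hY : f.inverseImage.essImage Y) : f.inverseImage.essImage X := by
  -- The equalizer of the characteristic map of the image of `m` with the constant map true is the
  -- image of `m`.
  let a := charMap Y (Set.range (fn m)) (act_mem_range_iff m)
  let b := charMap Y Set.univ (fun _ _ => Iff.rfl)
  have hab : m ≫ a = m ≫ b := hom_ext fun x =>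
    congrArg ULift.up (propext ⟨fun _ => trivial, fun _ => ⟨x, rfl⟩⟩)
  have hm := (mono_iff m).1 inferInstance
  have hmono : Mono (equalizer.lift m hab) := by
    have : Mono (equalizer.lift m hab ≫ equalizer.ι a b) := by
      rw [equalizer.lift_ι]; infer_instance
    exact mono_of_mono _ (equalizer.ι a b)
  have hepi : Epi (equalizer.lift m hab) := by
    rw [epi_iff]
    intro z
    have hz : fn a (fn (equalizer.ι a b) z) = fn b (fn (equalizer.ι a b) z) := by
      rw [← fn_comp, equalizer.condition, fn_comp]
    have hz' : (fn (equalizer.ι a b) z ∈ Set.range (fn m)) = True :=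
      congrArg (ULift.down (α := Prop)) hz
    obtain ⟨x, hx⟩ := hz'.symm ▸ trivial
    refine ⟨x, (mono_iff (equalizer.ι a b)).1 inferInstance ?_⟩
    rw [← fn_comp, equalizer.lift_ι, hx]
  have := isIso_of_mono_of_epi (equalizer.lift m hab)
  exact Functor.essImage.ofIso (asIso (equalizer.lift m hab)).symm
    (essImage_equalizer hf a b hY (essImage_two hf))

theorem isConnected_iff_isHyperconnected : f.IsConnected ↔ f.IsHyperconnected :=
  ⟨fun hf => ⟨hf, fun _ _ m _ hY => essImage_of_mono hf m hY⟩, fun hf => hf.1⟩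

/-- A `G`-set all of whose elements are hit from objects of the essential image belongs to the
essential image. -/
theorem essImage_of_cover (hf : f.IsConnected) {X : GSets G}
    (h : ∀ x : X.carrier, ∃ Y : GSets G, f.inverseImage.essImage Y ∧
      ∃ (g : Y ⟶ X) (y : Y.carrier), fn g y = x) : f.inverseImage.essImage X := by
  let T := f.inverseImage.obj (f.directImage.obj X)
  have hT : f.inverseImage.essImage T := Functor.obj_mem_essImage _ _
  let ε : T ⟶ X := f.adj.counit.app X
  have hepi : Epi ε := by
    rw [epi_iff]
    intro x
    obtain ⟨Y, hY, g, y, rfl⟩ := h x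
    obtain ⟨k, rfl⟩ := f.exists_comp_counit hY g
    exact ⟨fn k y, rfl⟩
  -- The kernel pair of `ε` is a subobject of `T ⨯ T`, so it lies in the essential image. Its
  -- projections agree after the counit, hence agree.
  have hmono : Mono ε := by
    have hm : Mono (prod.lift (pullback.fst ε ε) (pullback.snd ε ε)) := by
      constructor
      intro Z a b w
      apply pullback.hom_ext
      · simpa only [Category.assoc, prod.lift_fst] using w =≫ prod.fst
      · simpa only [Category.assoc, prod.lift_snd] using w =≫ prod.snd
    have hR := essImage_of_mono hf (prod.lift (pullback.fst ε ε) (pullback.snd ε ε))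
      (essImage_prod hf hT hT)
    have hfs : pullback.fst ε ε = pullback.snd ε ε :=
      hf.hom_ext_counit hR pullback.condition
    constructor
    intro Z a b w
    rw [← pullback.lift_fst a b w, hfs, pullback.lift_snd]
  have : IsIso ε := isIso_of_mono_of_epi ε
  exact f.inverseImage.essImage.prop_of_iso (asIso ε) hT

/-- The subgroups whose coset space lies in the essential image. -/
theorem essImage_cosets_iff (hf : f.IsConnected) (H : Subgroup G) :
    f.inverseImage.essImage (cosets H) ↔
      ∃ X, f.inverseImage.essImage X ∧ ∃ x : X.carrier, X.stabilizer x ≤ H := by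
  constructor
  · intro h
    exact ⟨_, h, cosets.base H, (cosets.stabilizer_base H).le⟩
  · rintro ⟨X, hX, x, hx⟩
    -- The orbit of `x` is a subobject of `X`, and it surjects onto `G/H` because `Stab(x) ≤ H`.
    have := cosets.mono_desc x
    have hS := essImage_of_mono hf (cosets.desc x le_rfl) hX
    refine essImage_of_cover hf fun y => ?_
    obtain ⟨g, rfl⟩ := cosets.exists_act_base y
    refine ⟨_, hS, cosets.desc (cosets.base H) (hx.trans (cosets.stabilizer_base H).ge),
      GSets.act _ (cosets.base _) g, ?_⟩
    rw [fn_act, cosets.fn_desc_base]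

/-- A `G`-set lies in the essential image iff the coset spaces of all its stabilizers do. -/
theorem essImage_iff_cosets (hf : f.IsConnected) (X : GSets G) :
    f.inverseImage.essImage X ↔
      ∀ x : X.carrier, f.inverseImage.essImage (cosets (X.stabilizer x)) :=
  ⟨fun hX x => (essImage_cosets_iff hf _).2 ⟨X, hX, x, le_rfl⟩, fun h =>
    essImage_of_cover hf fun x => ⟨_, h x, cosets.desc x le_rfl, cosets.base _,
      cosets.fn_desc_base x le_rfl⟩⟩

/-- The conjugate closed filter of a connected geometric morphism: the subgroups whose coset space
lies in the essential image of the inverse image. -/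
def conjClosedFilter (f : GeometricMorphism (GSets G) F) (hf : f.IsConnected) :
    ConjClosedFilter G :=
  ⟨(Order.IsPFilter.of_def (F := {H | f.inverseImage.essImage (cosets H)})
    ⟨⊤, (essImage_cosets_iff hf _).2
      ⟨_, essImage_two hf, (ULift.up True : ULift.{u} Prop), le_top⟩⟩
    (by
      intro H hH K hK
      refine ⟨H ⊓ K, (essImage_cosets_iff hf _).2 ⟨_, essImage_prod hf hH hK, ?_⟩,
        inf_le_left, inf_le_right⟩
      -- The pair of base points, whose stabilizer is contained in `H` and in `K`; it is reached by
      -- mapping `G/(H ⊓ K)` into the abstract product.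
      refine ⟨fn (prod.lift (cosets.desc (H := H ⊓ K) (cosets.base H) ?_)
        (cosets.desc (cosets.base K) ?_)) (cosets.base _), le_inf ?_ ?_⟩
      · rw [cosets.stabilizer_base]; exact inf_le_left
      · rw [cosets.stabilizer_base]; exact inf_le_right
      · refine (stabilizer_le_fn prod.fst _).trans ?_
        rw [← fn_comp, prod.lift_fst, cosets.fn_desc_base, cosets.stabilizer_base]
      · refine (stabilizer_le_fn prod.snd _).trans ?_
        rw [← fn_comp, prod.lift_snd, cosets.fn_desc_base, cosets.stabilizer_base])
    (by
      intro H K hHK hH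
      exact (essImage_cosets_iff hf _).2
        ⟨_, hH, cosets.base H, (cosets.stabilizer_base H).trans_le hHK⟩)).toPFilter,
    -- In `G/H`, the translate of the base point by `g⁻¹` has stabilizer `gHg⁻¹`.
    fun H hH g => (essImage_cosets_iff hf _).2
      ⟨cosets H, hH, GSets.act _ (cosets.base H) g⁻¹,
        ((stabilizer_act_inv _ _ _).trans
          (congrArg _ (cosets.stabilizer_base H))).le⟩⟩

theorem mem_conjClosedFilter (hf : f.IsConnected) {H : Subgroup G} :
    H ∈ (f.conjClosedFilter hf).1 ↔ f.inverseImage.essImage (cosets H) := Iff.rfl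

theorem essImage_iff_stabilizer_mem (hf : f.IsConnected) (X : GSets G) :
    f.inverseImage.essImage X ↔ ∀ x, X.stabilizer x ∈ (f.conjClosedFilter hf).1 :=
  essImage_iff_cosets hf X

end

end GeometricMorphism

/-! ## Conjugate closed filters and simple topologies -/

namespace ConjClosedFilter

variable {G : Type u} [Group G]

@[ext]
theorem ext {Φ Ψ : ConjClosedFilter G} (h : ∀ H, H ∈ Φ.1 ↔ H ∈ Ψ.1) : Φ = Ψ :=
  Subtype.ext (SetLike.ext h)

/-- The subgroups in a conjugate closed filter as a neighbourhood base of the identity. -/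
@[reducible]
def groupFilterBasis (Φ : ConjClosedFilter G) : GroupFilterBasis G where
  sets := {S | ∃ H ∈ Φ.1, (H : Set G) = S}
  nonempty := Φ.1.nonempty.elim fun H hH => ⟨H, H, hH, rfl⟩
  inter_sets := by
    rintro _ _ ⟨H, hH, rfl⟩ ⟨K, hK, rfl⟩
    exact ⟨_, ⟨H ⊓ K, Order.PFilter.inf_mem hH hK, rfl⟩, le_rfl⟩
  one' := by
    rintro _ ⟨H, hH, rfl⟩
    exact H.one_mem
  mul' := by
    rintro _ ⟨H, hH, rfl⟩
    exact ⟨_, ⟨H, hH, rfl⟩, Set.mul_subset_iff.2 fun _ ha _ hb => H.mul_mem ha hb⟩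
  inv' := by
    rintro _ ⟨H, hH, rfl⟩
    exact ⟨_, ⟨H, hH, rfl⟩, fun _ ha => H.inv_mem ha⟩
  conj' := by
    rintro g _ ⟨H, hH, rfl⟩
    -- A basic `V` with `gVg⁻¹ ⊆ H` is needed, so `H` is conjugated by `g⁻¹`.
    refine ⟨_, ⟨_, Φ.2 H hH g⁻¹, rfl⟩, ?_⟩
    rintro _ ⟨h, hh, rfl⟩
    change g * (g⁻¹ * h * g⁻¹⁻¹) * g⁻¹ ∈ H
    rwa [inv_inv, ← mul_assoc, mul_inv_cancel_right, mul_inv_cancel_left]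

/-- No new open subgroups arise: an open subgroup contains a basic neighbourhood `K ∈ Φ`, and Φ is
upward closed. -/
theorem isOpen_iff_mem (Φ : ConjClosedFilter G) (H : Subgroup G) :
    IsOpen[Φ.groupFilterBasis.topology] (H : Set G) ↔ H ∈ Φ.1 := by
  let := Φ.groupFilterBasis.topology
  have := Φ.groupFilterBasis.isTopologicalGroup
  have hb := Φ.groupFilterBasis.nhds_one_hasBasis
  constructor
  · intro hH
    obtain ⟨_, ⟨K, hK, rfl⟩, hKH⟩ := hb.mem_iff.1 (hH.mem_nhds H.one_mem)
    exact Order.PFilter.mem_of_le (show K ≤ H from hKH) hK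
  · intro hH
    exact H.isOpen_of_mem_nhds (g := 1) (hb.mem_of_mem ⟨H, hH, rfl⟩)

/-- The simple group topology whose open subgroups form the given filter. -/
def simpleGroupTopology (Φ : ConjClosedFilter G) : SimpleGroupTopology G :=
  ⟨{ toTopologicalSpace := Φ.groupFilterBasis.topology
     toIsTopologicalGroup := Φ.groupFilterBasis.isTopologicalGroup }, by
    let := Φ.groupFilterBasis.topology
    refine ⟨fun S => ?_⟩
    rw [Φ.groupFilterBasis.nhds_one_hasBasis.mem_iff]
    constructor
    · rintro ⟨_, ⟨H, hH, rfl⟩, hS⟩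
      exact ⟨H, (Φ.isOpen_iff_mem H).2 hH, hS⟩
    · rintro ⟨H, hH, hS⟩
      exact ⟨_, ⟨H, (Φ.isOpen_iff_mem H).1 hH, rfl⟩, hS⟩⟩

theorem isOpen_simpleGroupTopology_iff (Φ : ConjClosedFilter G) (H : Subgroup G) :
    IsOpen[Φ.simpleGroupTopology.topology] (H : Set G) ↔ H ∈ Φ.1 :=
  Φ.isOpen_iff_mem H

end ConjClosedFilter

namespace SimpleGroupTopology

variable {G : Type u} [Group G]

/-- A group topology is determined by its neighbourhoods of 1, and here the open subgroups are a
base of them. -/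
theorem ext_of_isOpen {τ σ : SimpleGroupTopology G}
    (h : ∀ H : Subgroup G, IsOpen[τ.topology] (H : Set G) ↔ IsOpen[σ.topology] (H : Set G)) :
    τ = σ := by
  have hn : @nhds G τ.topology 1 = @nhds G σ.topology 1 :=
    τ.2.eq_of_same_basis (by simpa only [h] using σ.2)
  exact Subtype.ext (GroupTopology.toTopologicalSpace_injective
    (IsTopologicalGroup.ext τ.1.toIsTopologicalGroup σ.1.toIsTopologicalGroup hn))

/-- The open subgroups of a group topology. -/
def openSubgroups (τ : SimpleGroupTopology G) : ConjClosedFilter G :=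
  letI := τ.topology
  haveI := τ.1.toIsTopologicalGroup
  ⟨(Order.IsPFilter.of_def (F := {H : Subgroup G | IsOpen (H : Set G)})
    ⟨⊤, isOpen_univ⟩
    (fun H hH K hK => ⟨H ⊓ K, IsOpen.inter hH hK, inf_le_left, inf_le_right⟩)
    (fun {_ _} hHK hH => Subgroup.isOpen_mono hHK hH)).toPFilter, fun H hH g => by
      have hH' : IsOpen (H : Set G) := hH
      change IsOpen ((H.map (MulAut.conj g).toMonoidHom : Subgroup G) : Set G)
      have : ((H.map (MulAut.conj g).toMonoidHom : Subgroup G) : Set G) =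
          (fun x => g⁻¹ * x * g) ⁻¹' (H : Set G) := by
        ext x
        exact Subgroup.mem_map_equiv (f := MulAut.conj g)
      rw [this]
      exact hH'.preimage (by fun_prop)⟩

end SimpleGroupTopology

/-- Conjugate closed filters correspond to simple group topologies. -/
def ConjClosedFilter.equivSimpleGroupTopology (G : Type u) [Group G] :
    ConjClosedFilter G ≃ SimpleGroupTopology G where
  toFun Φ := Φ.simpleGroupTopology
  invFun τ := τ.openSubgroups
  left_inv Φ := ConjClosedFilter.ext Φ.isOpen_iff_mem
  right_inv τ := SimpleGroupTopology.ext_of_isOpen fun H =>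
    τ.openSubgroups.isOpen_simpleGroupTopology_iff H

/-- A `G`-set is continuous iff all its stabilizers are open. -/
theorem GSets.isContinuous_iff {G : Type u} [Group G] (τ : SimpleGroupTopology G) (X : GSets G) :
    GSets.IsContinuous τ.topology X ↔
      ∀ x : X.carrier, IsOpen[τ.topology] (X.stabilizer x : Set G) := by
  let := τ.topology
  have := τ.1.toIsTopologicalGroup
  let : TopologicalSpace X.carrier := ⊥
  have : DiscreteTopology X.carrier := ⟨rfl⟩
  change Continuous (fun p : X.carrier × G => X.act p.1 p.2) ↔ _
  rw [continuous_prod_of_discrete_left]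
  constructor
  · intro h x
    exact (isOpen_discrete {x}).preimage (h x)
  · intro h x
    rw [continuous_def]
    intro S _
    rw [isOpen_iff_mem_nhds]
    intro g hg
    -- The orbit map of `x` is locally constant: it is constant on the coset `g · Stab(x · g)`, an
    -- open neighbourhood of `g`.
    have : (fun k => g⁻¹ * k) ⁻¹' (X.stabilizer (X.act x g) : Set G) ∈ 𝓝 g :=
      ((h (X.act x g)).preimage (by fun_prop)).mem_nhds (by simp [one_mem])
    filter_upwards [this] with k hk
    have hk' : X.act (X.act x g) (g⁻¹ * k) = X.act x g := hk
    rw [← act_mul, mul_inv_cancel_left] at hk'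
    change X.act x k ∈ S
    rwa [hk']

/-! ## The topos of `G`-sets with stabilizers in a filter -/

namespace ConjClosedFilter

variable {G : Type u} [Group G] (Φ : ConjClosedFilter G)

open GSets

/-- The `G`-sets all of whose stabilizers belong to the filter. -/
def stable : ObjectProperty (GSets G) := fun X => ∀ x : X.carrier, X.stabilizer x ∈ Φ.1

theorem stable_two : Φ.stable (two G) := fun _ =>
  Order.PFilter.mem_of_le (fun _ _ => two_act _ _) Order.PFilter.top_mem

theorem stabilizer_act_mem {X : GSets G} {x : X.carrier} (hx : X.stabilizer x ∈ Φ.1) (g : G) :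
    X.stabilizer (X.act x g) ∈ Φ.1 := by
  have := Φ.2 _ hx g⁻¹
  rwa [← stabilizer_act_inv, inv_inv] at this

theorem stable_cosets {H : Subgroup G} (hH : H ∈ Φ.1) : Φ.stable (cosets H) := fun x => by
  obtain ⟨g, rfl⟩ := cosets.exists_act_base x
  exact Φ.stabilizer_act_mem (by rwa [cosets.stabilizer_base]) g

instance : Φ.stable.IsClosedUnderIsomorphisms where
  of_iso e hX y := by
    have h := Order.PFilter.mem_of_le (stabilizer_le_fn e.hom (fn e.inv y)) (hX (fn e.inv y))
    rwa [← fn_comp, e.inv_hom_id, fn_id] at h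

theorem iInf_mem {ι : Type} [Finite ι] (H : ι → Subgroup G) (h : ∀ i, H i ∈ Φ.1) :
    ⨅ i, H i ∈ Φ.1 := by
  have := Fintype.ofFinite ι
  rw [← Finset.inf_univ_eq_iInf]
  exact Finset.inf_induction (p := (· ∈ Φ.1)) Order.PFilter.top_mem
    (fun _ ha _ hb => Order.PFilter.inf_mem ha hb) fun i _ => h i

/-- An element of a limit is determined by its components, so its stabilizer contains the
intersection of theirs, a finite one since `J` is finite. -/
instance (J : Type) [SmallCategory J] [FinCategory J] : Φ.stable.IsClosedUnderLimitsOfShape J where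
  limitsOfShape_le := by
    rintro X ⟨p⟩ x
    refine Order.PFilter.mem_of_le ?_
      (Φ.iInf_mem (fun j => (p.diag.obj j).stabilizer (fn (p.π.app j) x))
        fun j => p.prop_diag_obj j _)
    intro g hg
    rw [Subgroup.mem_iInf] at hg
    have hl := isLimitOfPreserves ((evaluation _ _).obj (op (SingleObj.star G))) p.isLimit
    refine Concrete.isLimit_ext _ hl _ _ fun j => ?_
    exact (fn_act (p.π.app j) x g).trans (hg j)

instance : HasFiniteLimits Φ.stable.FullSubcategory where
  out _ _ _ := inferInstance

instance : PreservesFiniteLimits Φ.stable.ι where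
  preservesFiniteLimits _ _ _ := inferInstance

/-- The sub-`G`-set of the elements whose stabilizers belong to the filter. -/
def core (X : GSets G) : GSets G where
  obj _ := {x : X.carrier // X.stabilizer x ∈ Φ.1}
  map {_ _} g := ↾fun x => ⟨X.act x.1 g.unop, Φ.stabilizer_act_mem x.2 _⟩
  map_id _ := by
    ext x
    exact X.act_one x.1
  map_comp {_ _ _} g h := by
    ext x
    exact X.act_mul x.1 g.unop h.unop

/-- The inclusion of the core. -/
def coreι (X : GSets G) : Φ.core X ⟶ X :=
  homMk (fun x : {x : X.carrier // X.stabilizer x ∈ Φ.1} => x.1) fun _ _ => rfl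

theorem stable_core (X : GSets G) : Φ.stable (Φ.core X) := fun x =>
  Order.PFilter.mem_of_le (fun _ hg => Subtype.ext hg)
    (show X.stabilizer (Subtype.val (p := fun x => X.stabilizer x ∈ Φ.1) x) ∈ Φ.1 from
      Subtype.property (p := fun x => X.stabilizer x ∈ Φ.1) x)

/-- A morphism from a stable `G`-set factors through the core. -/
def coreLift {X Y : GSets G} (hX : Φ.stable X) (f : X ⟶ Y) : X ⟶ Φ.core Y :=
  homMk (Y := Φ.core Y) (fun x => (⟨fn f x, Order.PFilter.mem_of_le (stabilizer_le_fn f x) (hX x)⟩ :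
    {y : Y.carrier // Y.stabilizer y ∈ Φ.1})) fun x g => Subtype.ext (fn_act f x g)

/-- The adjunction between the inclusion of the stable `G`-sets and the core. -/
def adjunction := Adjunction.adjunctionOfEquivRight (F := Φ.stable.ι)
    (G_obj := fun X => (⟨Φ.core X, Φ.stable_core X⟩ : Φ.stable.FullSubcategory))
    (fun X Y =>
      { toFun := fun f => ObjectProperty.homMk (Φ.coreLift X.2 f)
        invFun := fun f => f.hom ≫ Φ.coreι Y
        left_inv := fun _ => rfl
        right_inv := fun _ => rfl })
    (fun _ _ _ _ _ => rfl)

/-- The geometric morphism from the topos of `G`-sets to the category of stable `G`-sets. -/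
def geometricMorphism : GeometricMorphism (GSets G) Φ.stable.FullSubcategory where
  directImage := _
  inverseImage := Φ.stable.ι
  adj := Φ.adjunction
  preservesFiniteLimits := inferInstance

theorem isConnected_geometricMorphism : Φ.geometricMorphism.IsConnected :=
  ⟨inferInstanceAs Φ.stable.ι.Full, inferInstanceAs Φ.stable.ι.Faithful⟩

theorem essImage_geometricMorphism_iff (X : GSets G) :
    Φ.geometricMorphism.inverseImage.essImage X ↔ Φ.stable X := by
  constructor
  · rintro ⟨Y, ⟨e⟩⟩
    exact Φ.stable.prop_of_iso e Y.2
  · intro hX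
    exact ⟨⟨X, hX⟩, ⟨Iso.refl _⟩⟩

/-- The exponential functors of the stable `G`-sets: the core of the exponential of `G`-sets. -/
theorem isLeftAdjoint_prodFunctor (A : Φ.stable.FullSubcategory) :
    (prod.functor.obj A).IsLeftAdjoint := by
  -- Including and then multiplying by `B` has as right adjoint the exponential followed by the
  -- core. As the inclusion preserves products, the left adjoint lands in the stable `G`-sets, and
  -- the adjunction restricts to them.
  let B : GSets G := Φ.stable.ι.obj A
  let adj := Φ.geometricMorphism.adj.comp (Adjunction.ofIsLeftAdjoint (prod.functor.obj B))
  exact (adj.restrictFullyFaithful (Functor.FullyFaithful.id _) Φ.stable.fullyFaithfulι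
    (L := prod.functor.obj A)
    (R := Φ.stable.ι ⋙ Functor.rightAdjoint (prod.functor.obj B) ⋙ Φ.geometricMorphism.directImage)
    (Functor.leftUnitor _ ≪≫ (prodComparisonNatIso Φ.stable.ι A).symm)
    (Iso.refl _ ≪≫ (Functor.rightUnitor _).symm)).isLeftAdjoint

/-- The one-element set as a stable `G`-set. -/
def one : Φ.stable.FullSubcategory :=
  ⟨(Functor.const _).obj PUnit.{u + 1}, fun _ => Order.PFilter.mem_of_le (fun _ _ => rfl)
    Order.PFilter.top_mem⟩

/-- The one-element set is terminal. -/
def isTerminalOne : IsTerminal Φ.one :=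
  IsTerminal.ofUniqueHom
    (fun _ => ObjectProperty.homMk (homMk (fun _ => PUnit.unit.{u + 1}) fun _ _ => rfl))
    fun _ _ => by
      ext1
      exact hom_ext fun _ => rfl

/-- The two-element set as a stable `G`-set. -/
def bool : Φ.stable.FullSubcategory := ⟨two G, Φ.stable_two⟩

/-- The element `True` of the two-element set. -/
def truth : Φ.one ⟶ Φ.bool :=
  ObjectProperty.homMk (charMap Φ.one.1 Set.univ fun _ _ => Iff.rfl)

/-- The characteristic morphism of the range of a morphism. -/
def rangeMap {X Y : Φ.stable.FullSubcategory} (m : X ⟶ Y) : Y ⟶ Φ.bool :=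
  ObjectProperty.homMk (charMap Y.1 (Set.range (fn m.hom)) (act_mem_range_iff m.hom))

theorem injective_of_mono {X Y : Φ.stable.FullSubcategory} (m : X ⟶ Y) [Mono m] :
    Function.Injective (fn m.hom) := by
  have : Mono (Φ.stable.ι.map m) := inferInstance
  exact (mono_iff (Φ.stable.ι.map m)).1 this

/-- The two-element set classifies the subobjects of stable `G`-sets. -/
noncomputable def classifier : Subobject.Classifier Φ.stable.FullSubcategory :=
  Subobject.Classifier.mkOfTerminalΩ₀ Φ.one Φ.isTerminalOne Φ.bool Φ.truth
    (fun m _ => Φ.rangeMap m)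
    (fun {U X} m _ => by
      have hm := Φ.injective_of_mono m
      -- Commutativity of the square puts the image of `a` inside the range of `m`; the chosen
      -- preimages are unique by injectivity, which makes the lift equivariant.
      have hw {Z : Φ.stable.FullSubcategory} {a : Z ⟶ X} {b : Z ⟶ Φ.one}
          (w : a ≫ Φ.rangeMap m = b ≫ Φ.truth) (z : Z.1.carrier) :
          ∃ u, fn m.hom u = fn a.hom z := by
        have h : (fn a.hom z ∈ Set.range (fn m.hom)) = True :=
          congrArg (fun k : Z ⟶ _ => ULift.down (α := Prop) (fn k.hom z)) w
        exact of_eq_true h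
      refine ⟨⟨?_⟩, ⟨PullbackCone.IsLimit.mk _
        (fun s => ObjectProperty.homMk (homMk (fun z => (hw s.condition z).choose) ?_))
        ?_ ?_ ?_⟩⟩
      · ext1
        exact hom_ext fun x => congrArg ULift.up (propext ⟨fun _ => trivial, fun _ => ⟨x, rfl⟩⟩)
      · intro z g
        apply hm
        rw [(hw s.condition _).choose_spec, fn_act, fn_act, (hw s.condition _).choose_spec]
      · intro s
        ext1
        exact hom_ext fun z => (hw s.condition z).choose_spec
      · intro s
        exact Φ.isTerminalOne.hom_ext _ _
      · intro s l hl _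
        ext1
        refine hom_ext fun z => hm ?_
        refine Eq.trans ?_ (hw s.condition z).choose_spec.symm
        exact congrArg (fun k : s.pt ⟶ X => fn k.hom z) hl)
    (fun {U X} m _ χ h => by
      ext1
      refine hom_ext fun x => congrArg ULift.up (propext ⟨fun hx => ?_, ?_⟩)
      · let C : Φ.stable.FullSubcategory := ⟨cosets (X.1.stabilizer x), Φ.stable_cosets (X.2 x)⟩
        let a : C ⟶ X := ObjectProperty.homMk (cosets.desc x le_rfl)
        have w : a ≫ χ = Φ.isTerminalOne.from C ≫ Φ.truth := by
          ext1
          refine hom_ext fun c => ?_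
          obtain ⟨g, rfl⟩ := cosets.exists_act_base (show (cosets _).carrier from c)
          refine (fn_act _ _ _).trans ((two_act _ _).trans ?_)
          refine (congrArg (fn χ.hom) (cosets.fn_desc_base x le_rfl)).trans ?_
          exact congrArg ULift.up (propext ⟨fun _ => trivial, fun _ => hx⟩)
        refine ⟨fn (h.lift a _ w).hom (cosets.base _), ?_⟩
        exact (congrArg (fun k : C ⟶ X => fn k.hom (cosets.base _)) (h.lift_fst a _ w)).trans
          (cosets.fn_desc_base x le_rfl)
      · rintro ⟨u, rfl⟩
        have hu : ULift.down (α := Prop) (fn χ.hom (fn m.hom u)) = True :=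
          congrArg (fun k : U ⟶ _ => ULift.down (α := Prop) (fn k.hom u)) h.w
        exact of_eq_true hu)

instance : IsElementaryTopos Φ.stable.FullSubcategory where
  hasFiniteLimits := inferInstance
  exponentiable := Φ.isLeftAdjoint_prodFunctor
  hasSubobjectClassifier := ⟨⟨Φ.classifier⟩⟩

/-- The quotient of the topos of `G`-sets given by a conjugate closed filter. -/
def connectedMorphism : ConnectedMorphismFrom (GSets G) where
  codomain := Φ.stable.FullSubcategory
  morphism := Φ.geometricMorphism
  isConnected := Φ.isConnected_geometricMorphism

end ConjClosedFilter

/-! ## The correspondence -/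

/-- A fully faithful functor with essential image `P` exhibits its source as the full subcategory
on `P`. -/
theorem CategoryTheory.ObjectProperty.exists_equivalence_comp_iso_ι_iff {C : Type u₁}
    [Category.{v₁} C] {D : Type u₂} [Category.{v₂} D] (P : ObjectProperty C) [P.IsClosedUnderIsomorphisms]
    (L : D ⥤ C) [L.Full] [L.Faithful] :
    (∃ e : P.FullSubcategory ≌ D, Nonempty (e.functor ⋙ L ≅ P.ι)) ↔ L.essImage = P := by
  constructor
  · rintro ⟨e, ⟨α⟩⟩
    ext X
    constructor
    · rintro ⟨Y, ⟨i⟩⟩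
      exact P.prop_of_iso ((α.app _).symm ≪≫ L.mapIso (e.counitIso.app Y) ≪≫ i)
        (e.inverse.obj Y).2
    · intro hX
      exact ⟨_, ⟨α.app ⟨X, hX⟩⟩⟩
  · rintro rfl
    have : L.toEssImage.IsEquivalence := { }
    let e := L.toEssImage.asEquivalence
    exact ⟨e.symm, ⟨Functor.isoWhiskerLeft e.inverse L.toEssImageCompι.symm ≪≫
      (Functor.associator _ _ _).symm ≪≫
      Functor.isoWhiskerRight e.counitIso _ ≪≫ Functor.leftUnitor _⟩⟩

theorem ConjClosedFilter.isContinuous_eq_stable {G : Type u} [Group G]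
    (τ : SimpleGroupTopology G) : GSets.IsContinuous τ.topology = τ.openSubgroups.stable := by
  ext X
  exact GSets.isContinuous_iff τ X

namespace GeometricMorphism

variable {G : Type u} [Group G] {F : Type w} [Category.{v} F] [HasFiniteLimits F]
  {f : GeometricMorphism (GSets G) F}

/-- The filter can be read off from its stable `G`-sets: `H` is the stabilizer of the base point of
`G/H`, so `G/H` is stable exactly when `H ∈ Φ`. -/
theorem essImage_eq_stable_iff (hf : f.IsConnected) (Φ : ConjClosedFilter G) :
    f.inverseImage.essImage = Φ.stable ↔ f.conjClosedFilter hf = Φ := by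
  constructor
  · intro h
    ext H
    rw [mem_conjClosedFilter, h]
    constructor
    · intro hH
      rw [← GSets.cosets.stabilizer_base H]
      exact hH _
    · exact Φ.stable_cosets
  · rintro rfl
    ext X
    exact essImage_iff_stabilizer_mem hf X

theorem isInducedBy_iff (hf : f.IsConnected) (τ : SimpleGroupTopology G) :
    f.IsInducedBy τ.topology ↔ f.conjClosedFilter hf = τ.openSubgroups := by
  have := hf.1
  have := hf.2
  unfold IsInducedBy ContinuousGSets
  rw [ConjClosedFilter.isContinuous_eq_stable, ObjectProperty.exists_equivalence_comp_iso_ι_iff,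
    essImage_eq_stable_iff hf]

end GeometricMorphism

namespace ConnectedMorphismFrom

variable {G : Type u} [Group G]

instance {E : Type u₁} [Category.{v₁} E] (P : ConnectedMorphismFrom E) :
    HasFiniteLimits P.codomain :=
  P.isTopos.hasFiniteLimits

/-- The conjugate closed filter of a connected morphism from the topos of `G`-sets. -/
def conjClosedFilter (P : ConnectedMorphismFrom (GSets G)) : ConjClosedFilter G :=
  P.morphism.conjClosedFilter P.isConnected

theorem equiv_iff (P Q : ConnectedMorphismFrom (GSets G)) :
    P ≈ Q ↔ P.conjClosedFilter = Q.conjClosedFilter := by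
  have := P.isConnected.1
  have := P.isConnected.2
  have := Q.isConnected.1
  have := Q.isConnected.2
  have hP := (GeometricMorphism.essImage_eq_stable_iff P.isConnected _).2 rfl
  have hQ := (GeometricMorphism.essImage_eq_stable_iff Q.isConnected _).2 rfl
  -- Both morphisms are compared with the canonical model, the inclusion of the stable `G`-sets of
  -- the filter of `P`.
  have key {R : ConnectedMorphismFrom (GSets G)} :
      P.conjClosedFilter.connectedMorphism ≈ R ↔ P.conjClosedFilter = R.conjClosedFilter := by
    have := R.isConnected.1
    have := R.isConnected.2
    exact ((ObjectProperty.exists_equivalence_comp_iso_ι_iff _ R.morphism.inverseImage).trans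
      (GeometricMorphism.essImage_eq_stable_iff R.isConnected _)).trans eq_comm
  exact ⟨fun h => key.1 (Setoid.trans (key.2 rfl) h),
    fun h => Setoid.trans (Setoid.symm (key.2 rfl)) (key.2 h)⟩

theorem conjClosedFilter_connectedMorphism (Φ : ConjClosedFilter G) :
    Φ.connectedMorphism.conjClosedFilter = Φ :=
  (GeometricMorphism.essImage_eq_stable_iff _ _).1
    (funext fun X => propext (Φ.essImage_geometricMorphism_iff X))

end ConnectedMorphismFrom

/-- Quotients of the topos of `G`-sets correspond to conjugate closed filters. -/
def ConnectedQuotient.equivConjClosedFilter (G : Type u) [Group G] :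
    ConnectedQuotient (GSets G) ≃ ConjClosedFilter G where
  toFun := Quotient.lift (fun P => P.conjClosedFilter) fun P Q h => (P.equiv_iff Q).1 h
  invFun Φ := Φ.connectedMorphism.quotient
  left_inv := by
    rintro ⟨P⟩
    exact Quotient.sound
      ((ConnectedMorphismFrom.equiv_iff _ _).2
        (ConnectedMorphismFrom.conjClosedFilter_connectedMorphism _))
  right_inv := ConnectedMorphismFrom.conjClosedFilter_connectedMorphism

theorem mainTheorem9 (G : Type u) [Group G] :
    -- connected and hyperconnected quotients of the topos of `G`-sets are the same
    (∀ (F : Type w) [Category.{v} F] [IsElementaryTopos F] (f : GeometricMorphism (GSets G) F),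
      f.IsConnected ↔ f.IsHyperconnected) ∧
    -- quotients, conjugate closed filters and simple topologies correspond bijectively
    (∃ (Φ : ConnectedQuotient (GSets G) ≃ ConjClosedFilter G)
        (Ψ : ConnectedQuotient (GSets G) ≃ SimpleGroupTopology G),
      (∀ (P : ConnectedMorphismFrom (GSets G)) (X : GSets G),
        P.morphism.inverseImage.essImage X ↔
          ∀ x : X.carrier, X.stabilizer x ∈ (Φ P.quotient).1) ∧
      (∀ (P : ConnectedMorphismFrom (GSets G)) (τ : SimpleGroupTopology G),
        Ψ P.quotient = τ ↔ P.morphism.IsInducedBy τ.topology) ∧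
      (∀ (q : ConnectedQuotient (GSets G)) (H : Subgroup G),
        H ∈ (Φ q).1 ↔ IsOpen[(Ψ q).topology] (H : Set G))) ∧
    -- every quotient is induced by a simple topological group structure
    (∀ (F : Type w) [Category.{v} F] [IsElementaryTopos F] (f : GeometricMorphism (GSets G) F),
      f.IsConnected → ∃ τ : SimpleGroupTopology G, f.IsInducedBy τ.topology) := by
  refine ⟨fun F _ hF f => ?_, ⟨ConnectedQuotient.equivConjClosedFilter G,
    (ConnectedQuotient.equivConjClosedFilter G).trans
      (ConjClosedFilter.equivSimpleGroupTopology G), fun P X => ?_, fun P τ => ?_,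
      fun q H => ?_⟩, fun F _ hF f hf => ?_⟩
  · have := hF.hasFiniteLimits
    exact GeometricMorphism.isConnected_iff_isHyperconnected
  · exact GeometricMorphism.essImage_iff_stabilizer_mem P.isConnected X
  · rw [GeometricMorphism.isInducedBy_iff P.isConnected]
    exact (ConjClosedFilter.equivSimpleGroupTopology G).eq_symm_apply.symm
  · exact (ConjClosedFilter.isOpen_simpleGroupTopology_iff _ H).symm
  · have := hF.hasFiniteLimits
    exact ⟨(f.conjClosedFilter hf).simpleGroupTopology,
      (GeometricMorphism.isInducedBy_iff hf _).2
        ((ConjClosedFilter.equivSimpleGroupTopology G).symm_apply_apply _).symm⟩
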